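/- Let $(x,y,t)$ be coordinates on $\mathbb{R}^3$ (the Heisenberg group $H^1$), let $X=\partial_x+2y\,\partial_t$, $Y=\partial_y-2x\,\partial_t$, $\Delta_{H^1}=X^2+Y^2$, and consider the critical Kohn–Laplace equation $$F:=\Delta_{H^1}u+u^3=u_{xx}+u_{yy}+4(x^2+y^2)u_{tt}+4y\,u_{xt}-4x\,u_{yt}+u^3=0,$$ together with the Lagrangian $L=\tfrac12(Xu)^2+\tfrac12(Yu)^2-\tfrac14u^4$. For a smooth vector field $W=\xi\,\partial_x+\phi\,\partial_y+\tau\,\partial_t+\eta\,\partial_u$ on an open set $M\subseteq\mathbb{R}^3\times\mathbb{R}$ (coefficients being functions of $(x,y,t,u)$) let $W^{(k)}$ be its $k$-th prolongation to jets, and let $D_x,D_y,D_t$ be the total derivatives, $\mathrm{Div}(\varphi)=D_x\varphi_1+D_y\varphi_2+D_t\varphi_3$. Call $W$ - a *Lie point symmetry* of the equation on $M$ if $W^{(2)}F=0$ at every 2-jet over $M$ at which $F=0$; - a *variational symmetry* of $\int L$ on $M$ if $W^{(1)}L+L\,(D_x\xi+D_y\phi+D_t\tau)=0$ identically on 1-jets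 over $M$; - a *divergence symmetry* of $\int L$ on $M$ *with potential* $\varphi=(\varphi_1,\varphi_2,\varphi_3)$ if $\varphi$ is a smooth function of $(x,y,t)$, $u$ and finitely many derivatives of $u$, defined on jets over $M$, and $W^{(1)}L+L\,(D_x\xi+D_y\phi+D_t\tau)=\mathrm{Div}(\varphi)$ identically on jets over $M$; and a *divergence symmetry* if such a $\varphi$ exists. **Theorem 2.** For every open $M\subseteq\mathbb{R}^3\times\mathbb{R}$, every Lie point symmetry of $\Delta_{H^1}u+u^3=0$ on $M$ is a divergence symmetry of $\int L$ on $M$. Moreover, the following eight vector fields are Lie point symmetries on $M=\mathbb{R}^3\times\mathbb{R}$: $$T=\partial_t,\quad R=y\,\partial_x-x\,\partial_y,\quad \tilde X=\partial_x-2y\,\partial_t,\quad \tilde Y=\partial_y+2x\,\partial_t,\quad Z=x\,\partial_x+y\,\partial_y+2t\,\partial_t-u\,\partial_u,$$ $$V_1=(xt-x^2y-y^3)\partial_x+(yt+x^3+xy^2)\partial_y+(t^2-(x^2+y^2)^2)\partial_t-tu\,\partial_u,$$ $$V_2=(t-4xy)\partial_x+(3x^2-y^2)\partial_y-(2yt+2x^3+2xy^2)\partial_t+2yu\,\partial_u,$$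 $$V_3=(x^2-3y^2)\partial_x+(t+4xy)\partial_y+(2xt-2x^2y-2y^3)\partial_t-2xu\,\partial_u.$$ The fields $T,R,\tilde X,\tilde Y,Z$ are variational symmetries of $\int L$, and $V_1,V_2,V_3$ are divergence symmetries of $\int L$ with potentials, respectively, $$A=(-yu^2,\;xu^2,\;-2(x^2+y^2)u^2),\qquad B=(0,\;u^2,\;-2xu^2),\qquad C=(-u^2,\;0,\;-2yu^2).$$ -/

import Mathlib

open scoped ContDiff

namespace KohnLaplace

/-! ### Jet spaces over `ℝ³` with coordinates `(x, y, t) = (p 0, p 1, p 2)` -/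

/-- Multi-indices `α = (α₀, α₁, α₂)` of order `|α| ≤ n`. -/
abbrev Idx (n : ℕ) : Type := {α : Fin 3 → ℕ // ∑ i, α i ≤ n}

instance instFintypeIdx (n : ℕ) : Fintype (Idx n) :=
  Fintype.subtype
    ((Fintype.piFinset fun _ : Fin 3 => Finset.range (n + 1)).filter fun α => ∑ i, α i ≤ n)
    (by
      intro α
      simp only [Finset.mem_filter, Fintype.mem_piFinset, Finset.mem_range, and_iff_right_iff_imp]
      intro h i
      have := Finset.single_le_sum (f := α) (fun _ _ => Nat.zero_le _) (Finset.mem_univ i)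
      omega)

/-- The multi-index `eᵢ`. -/
abbrev e (i : Fin 3) : Fin 3 → ℕ := Pi.single i 1

lemma sum_add_e_le {n : ℕ} {α : Fin 3 → ℕ} (h : ∑ j, α j ≤ n) (i : Fin 3) :
    ∑ j, (α + e i) j ≤ n + 1 := by
  simp only [Pi.add_apply, Finset.sum_add_distrib, Finset.sum_pi_single', Finset.mem_univ, if_true]
  omega

/-- The space of independent and dependent variables `((x, y, t), u)`. -/
abbrev Base : Type := (Fin 3 → ℝ) × ℝ

/-- The `n`-th jet space: points `((x, y, t), (u_α)_{|α| ≤ n})`. -/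
abbrev Jet (n : ℕ) : Type := (Fin 3 → ℝ) × (Idx n → ℝ)

/-- The natural projection `J^n → J^m` for `m ≤ n`. -/
def proj {m n : ℕ} (h : m ≤ n) (z : Jet n) : Jet m :=
  (z.1, fun α => z.2 ⟨α.1, α.2.trans h⟩)

/-- The projection `J^n → Base`, `z ↦ ((x, y, t), u)`. -/
def toBase {n : ℕ} (z : Jet n) : Base := (z.1, z.2 ⟨0, by simp⟩)

/-- The part of `J^n` lying over `M ⊆ Base`. -/
def jetsOver (n : ℕ) (M : Set Base) : Set (Jet n) := {z | toBase z ∈ M}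

/-- The coordinate `uᵢ = ∂u/∂xᵢ` on `J^1`. -/
def u₁ (i : Fin 3) (z : Jet 1) : ℝ := z.2 ⟨e i, by simp⟩

/-- The coordinate `uᵢⱼ = ∂²u/∂xᵢ∂xⱼ` on `J^2`. -/
def u₂ (i j : Fin 3) (z : Jet 2) : ℝ :=
  z.2 ⟨e i + e j, sum_add_e_le (n := 1) (by simp) j⟩

/-- The total derivative `Dᵢ P = ∂P/∂xᵢ + ∑_α u_{α + eᵢ} ∂P/∂u_α`. -/
noncomputable def D {n : ℕ} (i : Fin 3) (P : Jet n → ℝ) (z : Jet (n + 1)) : ℝ :=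
  fderiv ℝ P (proj n.le_succ z)
    (Pi.single i 1, fun α => z.2 ⟨α.1 + e i, sum_add_e_le α.2 i⟩)

/-- The total divergence of a triple of differential functions. -/
noncomputable def Div {n : ℕ} (φ : Fin 3 → Jet n → ℝ) (z : Jet (n + 1)) : ℝ :=
  ∑ i, D i (φ i) z

/-- The partial derivative `∂P/∂xᵢ` of a function on the jet space. -/
noncomputable def pdX {n : ℕ} (i : Fin 3) (P : Jet n → ℝ) (z : Jet n) : ℝ :=
  fderiv ℝ P z (Pi.single i 1, 0)

/-- The partial derivative `∂P/∂u_α` of a function on the jet space. -/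
noncomputable def pdU {n : ℕ} (α : Idx n) (P : Jet n → ℝ) (z : Jet n) : ℝ :=
  fderiv ℝ P z (0, Pi.single α 1)

/-! ### Point vector fields and their prolongations -/

/-- The coefficients of `W = ξ₀ ∂/∂x + ξ₁ ∂/∂y + ξ₂ ∂/∂t + η ∂/∂u`, functions of `((x, y, t), u)`. -/
structure PointField where
  ξ : Fin 3 → Base → ℝ
  η : Base → ℝ

namespace PointField

variable (W : PointField)

/-- `W` is a smooth vector field on `M`. -/
def SmoothOn (M : Set Base) : Prop :=
  (∀ i, ContDiffOn ℝ ∞ (W.ξ i) M) ∧ ContDiffOn ℝ ∞ W.η M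

/-- The total derivative `Dᵢ ξⱼ`, a function on `J^1`. -/
noncomputable def Dξ (i j : Fin 3) : Jet 1 → ℝ := D i fun z : Jet 0 => W.ξ j (toBase z)

/-- `ηᵢ = Dᵢ η - ∑ⱼ uⱼ Dᵢ ξⱼ`, the coefficient of `∂/∂uᵢ` in the prolongation of `W`. -/
noncomputable def η₁ (i : Fin 3) (z : Jet 1) : ℝ :=
  D i (fun z : Jet 0 => W.η (toBase z)) z - ∑ j, u₁ j z * W.Dξ i j z

/-- `ηᵢⱼ = Dⱼ ηᵢ - ∑ₖ uᵢₖ Dⱼ ξₖ`, the coefficient of `∂/∂uᵢⱼ` in the prolongation of `W`. -/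
noncomputable def η₂ (i j : Fin 3) (z : Jet 2) : ℝ :=
  D j (W.η₁ i) z - ∑ k, u₂ i k z * W.Dξ j k (proj one_le_two z)

/-- The first prolongation `W⁽¹⁾` acting on a function on `J^1`. -/
noncomputable def pr₁ (P : Jet 1 → ℝ) (z : Jet 1) : ℝ :=
  ∑ i, W.ξ i (toBase z) * pdX i P z
    + W.η (toBase z) * pdU ⟨0, by simp⟩ P z
    + ∑ i, W.η₁ i z * pdU ⟨e i, by simp⟩ P z

/-- The second prolongation `W⁽²⁾` acting on a function on `J^2`; each second-order coordinate
`uᵢⱼ = uⱼᵢ` is counted once. -/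
noncomputable def pr₂ (P : Jet 2 → ℝ) (z : Jet 2) : ℝ :=
  ∑ i, W.ξ i (toBase z) * pdX i P z
    + W.η (toBase z) * pdU ⟨0, by simp⟩ P z
    + ∑ i, W.η₁ i (proj one_le_two z) * pdU ⟨e i, by simp⟩ P z
    + ∑ i, ∑ j ∈ Finset.Ici i,
        W.η₂ i j z * pdU ⟨e i + e j, sum_add_e_le (n := 1) (by simp) j⟩ P z

/-- `W`, a vector field on `M`, generates Lie point symmetries of the second-order equation
`F = 0`: `W⁽²⁾ F` vanishes at all points of `F = 0` over `M`. -/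
def IsLiePointSymmetry (F : Jet 2 → ℝ) (M : Set Base) : Prop :=
  W.SmoothOn M ∧ ∀ z ∈ jetsOver 2 M, F z = 0 → W.pr₂ F z = 0

/-- The expression `W⁽¹⁾ L + L (D_x ξ₀ + D_y ξ₁ + D_t ξ₂)`, a function on `J^1`. -/
noncomputable def variationOf (L : Jet 1 → ℝ) (z : Jet 1) : ℝ :=
  W.pr₁ L z + L z * ∑ i, W.Dξ i i z

/-- `W`, a vector field on `M`, is a variational symmetry of `∫ L`. -/
def IsVariationalSymmetry (L : Jet 1 → ℝ) (M : Set Base) : Prop :=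
  W.SmoothOn M ∧ ∀ z ∈ jetsOver 1 M, W.variationOf L z = 0

/-- `W`, a vector field on `M`, satisfies `W⁽¹⁾ L + L Div(ξ) = Div(φ)`, where the potential `φ`
is a smooth function of `(x, y, t)`, `u` and the derivatives of `u` of order at most `n`. -/
def IsDivergenceSymmetryWith (L : Jet 1 → ℝ) (M : Set Base) {n : ℕ}
    (φ : Fin 3 → Jet n → ℝ) : Prop :=
  W.SmoothOn M ∧ (∀ i, ContDiffOn ℝ ∞ (φ i) (jetsOver n M)) ∧
    ∀ z ∈ jetsOver (n + 1) M, W.variationOf L (proj (Nat.le_add_left 1 n) z) = Div φ z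

/-- `W`, a vector field on `M`, is a divergence symmetry of `∫ L`. -/
def IsDivergenceSymmetry (L : Jet 1 → ℝ) (M : Set Base) : Prop :=
  ∃ (n : ℕ) (φ : Fin 3 → Jet n → ℝ), W.IsDivergenceSymmetryWith L M φ

end PointField

/-! ### The critical Kohn-Laplace equation on `H¹` -/

/-- The dependent variable `u` as a function on `J^0`. -/
def u₀ (z : Jet 0) : ℝ := (toBase z).2

/-- `X = ∂/∂x + 2y ∂/∂t` acting on differential functions. -/
noncomputable def X {n : ℕ} (P : Jet n → ℝ) (z : Jet (n + 1)) : ℝ :=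
  D 0 P z + 2 * z.1 1 * D 2 P z

/-- `Y = ∂/∂y - 2x ∂/∂t` acting on differential functions. -/
noncomputable def Y {n : ℕ} (P : Jet n → ℝ) (z : Jet (n + 1)) : ℝ :=
  D 1 P z - 2 * z.1 0 * D 2 P z

/-- The left-hand side `(X² + Y²) u + u³` of the critical Kohn-Laplace equation. -/
noncomputable def criticalEq (z : Jet 2) : ℝ :=
  X (X u₀) z + Y (Y u₀) z + (toBase z).2 ^ 3

/-- The Lagrangian `L = ½ (Xu)² + ½ (Yu)² - u⁴/4`. -/
noncomputable def lagrangian (z : Jet 1) : ℝ :=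
  1 / 2 * X u₀ z ^ 2 + 1 / 2 * Y u₀ z ^ 2 - (toBase z).2 ^ 4 / 4

/-- The point field `ξ ∂/∂x + φ ∂/∂y + τ ∂/∂t + η ∂/∂u` with coefficients written as functions
of `x y t u`. -/
def field (ξ φ τ η : ℝ → ℝ → ℝ → ℝ → ℝ) : PointField where
  ξ := ![fun q => ξ (q.1 0) (q.1 1) (q.1 2) q.2, fun q => φ (q.1 0) (q.1 1) (q.1 2) q.2,
    fun q => τ (q.1 0) (q.1 1) (q.1 2) q.2]
  η := fun q => η (q.1 0) (q.1 1) (q.1 2) q.2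

/-- Translations in `t`. -/
def fieldT : PointField :=
  field (fun _ _ _ _ => 0) (fun _ _ _ _ => 0) (fun _ _ _ _ => 1) (fun _ _ _ _ => 0)

/-- Rotations in the `x`-`y` plane. -/
def fieldR : PointField :=
  field (fun _ y _ _ => y) (fun x _ _ _ => -x) (fun _ _ _ _ => 0) (fun _ _ _ _ => 0)

/-- `X̃ = ∂/∂x - 2y ∂/∂t`. -/
def fieldXt : PointField :=
  field (fun _ _ _ _ => 1) (fun _ _ _ _ => 0) (fun _ y _ _ => -2 * y) (fun _ _ _ _ => 0)

/-- `Ỹ = ∂/∂y + 2x ∂/∂t`. -/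
def fieldYt : PointField :=
  field (fun _ _ _ _ => 0) (fun _ _ _ _ => 1) (fun x _ _ _ => 2 * x) (fun _ _ _ _ => 0)

/-- The dilation `Z = x ∂/∂x + y ∂/∂y + 2t ∂/∂t - u ∂/∂u`. -/
def fieldZ : PointField :=
  field (fun x _ _ _ => x) (fun _ y _ _ => y) (fun _ _ t _ => 2 * t) (fun _ _ _ u => -u)

/-- The conformal generator `V₁`. -/
def fieldV₁ : PointField :=
  field (fun x y t _ => x * t - x ^ 2 * y - y ^ 3) (fun x y t _ => y * t + x ^ 3 + x * y ^ 2)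
    (fun x y t _ => t ^ 2 - (x ^ 2 + y ^ 2) ^ 2) (fun _ _ t u => -(t * u))

/-- The conformal generator `V₂`. -/
def fieldV₂ : PointField :=
  field (fun x y t _ => t - 4 * x * y) (fun x y _ _ => 3 * x ^ 2 - y ^ 2)
    (fun x y t _ => -(2 * y * t + 2 * x ^ 3 + 2 * x * y ^ 2)) (fun _ y _ u => 2 * y * u)

/-- The conformal generator `V₃`. -/
def fieldV₃ : PointField :=
  field (fun x y _ _ => x ^ 2 - 3 * y ^ 2) (fun x y t _ => t + 4 * x * y)
    (fun x y t _ => 2 * x * t - 2 * x ^ 2 * y - 2 * y ^ 3) (fun x _ _ u => -(2 * x * u))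

/-- A potential depending only on `x y t u`, as a triple of functions on `J^0`. -/
def potential (φ : Fin 3 → ℝ → ℝ → ℝ → ℝ → ℝ) (i : Fin 3) (z : Jet 0) : ℝ :=
  φ i (z.1 0) (z.1 1) (z.1 2) (u₀ z)

/-- `A = (-yu², xu², -2(x² + y²)u²)`. -/
def potentialA : Fin 3 → Jet 0 → ℝ :=
  potential ![fun _ y _ u => -(y * u ^ 2), fun x _ _ u => x * u ^ 2,
    fun x y _ u => -2 * (x ^ 2 + y ^ 2) * u ^ 2]

/-- `B = (0, u², -2xu²)`. -/
def potentialB : Fin 3 → Jet 0 → ℝ :=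
  potential ![fun _ _ _ _ => 0, fun _ _ _ u => u ^ 2, fun x _ _ u => -2 * x * u ^ 2]

/-- `C = (-u², 0, -2yu²)`. -/
def potentialC : Fin 3 → Jet 0 → ℝ :=
  potential ![fun _ _ _ u => -u ^ 2, fun _ _ _ _ => 0, fun _ y _ u => -2 * y * u ^ 2]

end KohnLaplace

/-! Write subscript u for ∂/∂u and let X, Y act on the base at fixed u. On F = 0 the second
derivatives enter the symmetry condition affinely and, once u_xx is eliminated, freely. Its
coefficients give the determining equations: ξ does not depend on u, η is affine in u, (ξ₀, ξ₁)
satisfies Cauchy-Riemann equations for X, Y, and Xξ₂, Yξ₂ are prescribed. What remains is Δη + 3u²η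
= (η_u - 2Xξ₀)u³; comparing powers of u (`eq_of_cubic_relation`) yields η = u η_u, Xξ₀ = -η_u and Δη
= 0.

The bracket [X, Y] = -4∂_t converts the equations for ξ into div ξ = 4 Xξ₀, where 4 is the
homogeneous dimension. At the critical exponent all terms in (Xu)², (Yu)² and u⁴ then cancel in the
variation of L, leaving Xu·Xη + Yu·Yη. As η is linear in u and Δη = 0, this is the total divergence
of (u/2)(Xη, Yη, 2yXη - 2xYη).

For `fieldV₁`, `fieldV₂`, `fieldV₃` this potential is A, B, C; for the other five fields Xη = Yη =
0. The claims about the eight fields are nevertheless checked directly, as polynomial identities in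
the jet coordinates. -/

namespace KohnLaplace

/-! ### Directional derivatives on the base -/

/-- The derivative of `g` at `q` in the direction `v`. -/
noncomputable def dirD (v : Base) (g : Base → ℝ) (q : Base) : ℝ := fderiv ℝ g q v

/-- The coordinate direction `∂/∂xᵢ`. -/
abbrev bX (i : Fin 3) : Base := (Pi.single i 1, 0)

/-- The coordinate direction `∂/∂u`. -/
abbrev bU : Base := (0, 1)

section dirD

variable {f g : Base → ℝ} {q v w : Base} {M : Set Base}

lemma contDiffAt_of_mem (hM : IsOpen M) (hg : ContDiffOn ℝ ∞ g M) (hq : q ∈ M) :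
    ContDiffAt ℝ ∞ g q :=
  hg.contDiffAt (hM.mem_nhds hq)

lemma differentiableAt_of_mem (hM : IsOpen M) (hg : ContDiffOn ℝ ∞ g M) (hq : q ∈ M) :
    DifferentiableAt ℝ g q :=
  (contDiffAt_of_mem hM hg hq).differentiableAt (by simp)

lemma contDiffOn_dirD (hM : IsOpen M) (hg : ContDiffOn ℝ ∞ g M) (v : Base) :
    ContDiffOn ℝ ∞ (dirD v g) M :=
  (hg.fderiv_of_isOpen hM (m := ∞) le_rfl).clm_apply contDiffOn_const

lemma dirD_comm (hM : IsOpen M) (hg : ContDiffOn ℝ ∞ g M) (hq : q ∈ M) (v w : Base) :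
    dirD v (dirD w g) q = dirD w (dirD v g) q := by
  have h := contDiffAt_of_mem hM hg hq
  have hd : DifferentiableAt ℝ (fderiv ℝ g) q :=
    (h.fderiv_right (m := 1) (WithTop.coe_le_coe.2 le_top)).differentiableAt (by simp)
  have key : ∀ a b : Base, dirD a (dirD b g) q = fderiv ℝ (fderiv ℝ g) q a b := by
    intro a b
    have : HasFDerivAt (fun p => fderiv ℝ g p b) ((fderiv ℝ (fderiv ℝ g) q).flip b) q := by
      simpa using hd.hasFDerivAt.clm_apply (hasFDerivAt_const b q)
    simp only [dirD]
    rw [show dirD b g = fun p => fderiv ℝ g p b from rfl, this.fderiv]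
    rfl
  rw [key, key]
  exact (h.isSymmSndFDerivAt (by
    simpa using (WithTop.coe_le_coe.2 le_top : ((2 : ℕ∞) : WithTop ℕ∞) ≤ ∞))) v w

/-- Openness of M is what allows identities on M to be differentiated; the determining equations are
exploited in this way. -/
lemma dirD_congr (hM : IsOpen M) (hq : q ∈ M) (h : ∀ p ∈ M, f p = g p) (v : Base) :
    dirD v f q = dirD v g q := by
  have : f =ᶠ[nhds q] g := Filter.eventuallyEq_of_mem (hM.mem_nhds hq) h
  rw [dirD, dirD, this.fderiv_eq]

lemma dirD_fun_const (c : ℝ) : dirD v (fun _ => c) = fun _ => 0 := by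
  funext q; simp [dirD]

lemma dirD_fun_zero : dirD v (fun _ => (0 : ℝ)) q = 0 := by
  simp [dirD]

lemma dirD_add_at (hf : DifferentiableAt ℝ f q) (hg : DifferentiableAt ℝ g q) :
    dirD v (fun p => f p + g p) q = dirD v f q + dirD v g q := by
  simp [dirD, fderiv_fun_add hf hg]

lemma dirD_sub_at (hf : DifferentiableAt ℝ f q) (hg : DifferentiableAt ℝ g q) :
    dirD v (fun p => f p - g p) q = dirD v f q - dirD v g q := by
  simp [dirD, fderiv_fun_sub hf hg]

lemma dirD_neg_at : dirD v (fun p => -f p) q = -dirD v f q := by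
  simp [dirD, fderiv_fun_neg]

lemma dirD_mul_at (hf : DifferentiableAt ℝ f q) (hg : DifferentiableAt ℝ g q) :
    dirD v (fun p => f p * g p) q = f q * dirD v g q + g q * dirD v f q := by
  simp [dirD, fderiv_fun_mul hf hg]

lemma dirD_pow_at (hf : DifferentiableAt ℝ f q) (n : ℕ) :
    dirD v (fun p => f p ^ n) q = n * f q ^ (n - 1) * dirD v f q := by
  simp [dirD, fderiv_fun_pow n hf, mul_assoc]

lemma dirD_coord_at (i : Fin 3) : dirD v (fun p => p.1 i) q = v.1 i := by
  have : HasFDerivAt (fun p : Base => p.1 i)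
      ((ContinuousLinearMap.proj i).comp (ContinuousLinearMap.fst ℝ (Fin 3 → ℝ) ℝ)) q :=
    ((ContinuousLinearMap.proj i).comp (ContinuousLinearMap.fst ℝ (Fin 3 → ℝ) ℝ)).hasFDerivAt
  rw [dirD, this.fderiv]; rfl

lemma dirD_snd_at : dirD v (fun p => p.2) q = v.2 := by
  have : HasFDerivAt (fun p : Base => p.2) (ContinuousLinearMap.snd ℝ (Fin 3 → ℝ) ℝ) q :=
    (ContinuousLinearMap.snd ℝ (Fin 3 → ℝ) ℝ).hasFDerivAt
  rw [dirD, this.fderiv]; rfl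

end dirD

/-! ### Total derivatives -/

section total

variable {n : ℕ} {P Q : Jet n → ℝ} {z : Jet (n + 1)} {i : Fin 3}

lemma D_add (hP : DifferentiableAt ℝ P (proj n.le_succ z))
    (hQ : DifferentiableAt ℝ Q (proj n.le_succ z)) :
    D i (fun w => P w + Q w) z = D i P z + D i Q z := by
  simp [D, fderiv_fun_add hP hQ]

lemma D_sub (hP : DifferentiableAt ℝ P (proj n.le_succ z))
    (hQ : DifferentiableAt ℝ Q (proj n.le_succ z)) :
    D i (fun w => P w - Q w) z = D i P z - D i Q z := by
  simp [D, fderiv_fun_sub hP hQ]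

lemma D_mul (hP : DifferentiableAt ℝ P (proj n.le_succ z))
    (hQ : DifferentiableAt ℝ Q (proj n.le_succ z)) :
    D i (fun w => P w * Q w) z =
      P (proj n.le_succ z) * D i Q z + Q (proj n.le_succ z) * D i P z := by
  simp [D, fderiv_fun_mul hP hQ]

lemma D_sum {ι : Type*} {s : Finset ι} {P : ι → Jet n → ℝ}
    (hP : ∀ k ∈ s, DifferentiableAt ℝ (P k) (proj n.le_succ z)) :
    D i (fun w => ∑ k ∈ s, P k w) z = ∑ k ∈ s, D i (P k) z := by
  simp [D, fderiv_fun_sum hP]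

lemma D_congr {U : Set (Jet n)} (hU : IsOpen U) (hz : proj n.le_succ z ∈ U)
    (h : ∀ w ∈ U, P w = Q w) : D i P z = D i Q z := by
  have : P =ᶠ[nhds (proj n.le_succ z)] Q := Filter.eventuallyEq_of_mem (hU.mem_nhds hz) h
  rw [D, D, this.fderiv_eq]

/-- The projection to the base as a continuous linear map. -/
def toBaseL (n : ℕ) : Jet n →L[ℝ] Base :=
  (ContinuousLinearMap.fst ℝ _ _).prod
    ((ContinuousLinearMap.proj (⟨0, by simp⟩ : Idx n)).comp (ContinuousLinearMap.snd ℝ _ _))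

lemma hasFDerivAt_toBase (z : Jet n) : HasFDerivAt (toBase (n := n)) (toBaseL n) z :=
  (toBaseL n).hasFDerivAt

lemma contDiff_toBase : ContDiff ℝ ∞ (toBase (n := n)) := (toBaseL n).contDiff

lemma isOpen_jetsOver {M : Set Base} (hM : IsOpen M) : IsOpen (jetsOver n M) :=
  hM.preimage (toBaseL n).continuous

lemma differentiableAt_comp_toBase {g : Base → ℝ} {z : Jet n}
    (hg : DifferentiableAt ℝ g (toBase z)) :
    DifferentiableAt ℝ (fun z : Jet n => g (toBase z)) z :=
  hg.comp z (hasFDerivAt_toBase z).differentiableAt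

lemma differentiable_u₁ (i : Fin 3) : Differentiable ℝ (u₁ i) := by
  unfold u₁; fun_prop

/-- Chain rule: the shift direction defining the total derivative projects to ∂ᵢ + uᵢ ∂_u on the
base. -/
lemma D_comp_toBase {g : Base → ℝ} (hg : DifferentiableAt ℝ g (toBase z)) :
    D i (fun w : Jet n => g (toBase w)) z =
      dirD (bX i) g (toBase z) + u₁ i (proj (Nat.le_add_left 1 n) z) * dirD bU g (toBase z) := by
  have h : HasFDerivAt (fun w : Jet n => g (toBase w)) ((fderiv ℝ g (toBase z)).comp (toBaseL n))
      (proj n.le_succ z) :=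
    HasFDerivAt.comp (proj n.le_succ z) (g := g) (f := toBase)
      (hg.hasFDerivAt : HasFDerivAt g _ (toBase (proj n.le_succ z))) (hasFDerivAt_toBase _)
  rw [D, h.fderiv, ContinuousLinearMap.comp_apply]
  have hv : toBaseL n (Pi.single i 1, fun α : Idx n => z.2 ⟨α.1 + e i, sum_add_e_le α.2 i⟩) =
      bX i + u₁ i (proj (Nat.le_add_left 1 n) z) • bU := by
    ext j
    · simp [toBaseL]
    · simp [toBaseL, u₁, proj]
  rw [hv, map_add, map_smul, smul_eq_mul, dirD, dirD]

lemma D_coord (k : Fin 3) : D i (fun w : Jet n => w.1 k) z = if k = i then 1 else 0 := by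
  have : HasFDerivAt (fun p : Jet n => p.1 k)
      ((ContinuousLinearMap.proj k).comp (ContinuousLinearMap.fst ℝ (Fin 3 → ℝ) (Idx n → ℝ)))
      (proj n.le_succ z) :=
    ((ContinuousLinearMap.proj k).comp (ContinuousLinearMap.fst ℝ (Fin 3 → ℝ) (Idx n → ℝ))).hasFDerivAt
  rw [D, this.fderiv]
  simp [Pi.single_apply]

end total

lemma D_u₁ (i k : Fin 3) (z : Jet 2) : D i (u₁ k) z = u₂ k i z := by
  have : HasFDerivAt (u₁ k)
      ((ContinuousLinearMap.proj (⟨e k, by simp⟩ : Idx 1)).comp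
        (ContinuousLinearMap.snd ℝ (Fin 3 → ℝ) (Idx 1 → ℝ)))
      (proj (Nat.le_succ 1) z) :=
    ((ContinuousLinearMap.proj (⟨e k, by simp⟩ : Idx 1)).comp
        (ContinuousLinearMap.snd ℝ (Fin 3 → ℝ) (Idx 1 → ℝ))).hasFDerivAt
  rw [D, this.fderiv]
  rfl

lemma u₂_comm (i j : Fin 3) (z : Jet 2) : u₂ i j z = u₂ j i z := by
  simp only [u₂, add_comm (e i)]

/-- The second total derivative of a function on the base. -/
lemma D_D_comp_toBase {M : Set Base} (hM : IsOpen M) {g : Base → ℝ} (hg : ContDiffOn ℝ ∞ g M)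
    {z : Jet 2} (hz : toBase z ∈ M) (i j : Fin 3) :
    D j (D i fun w : Jet 0 => g (toBase w)) z =
      dirD (bX j) (dirD (bX i) g) (toBase z)
        + u₁ j (proj one_le_two z) * dirD (bX i) (dirD bU g) (toBase z)
        + u₁ i (proj one_le_two z) * dirD (bX j) (dirD bU g) (toBase z)
        + u₁ i (proj one_le_two z) * u₁ j (proj one_le_two z) * dirD bU (dirD bU g) (toBase z)
        + u₂ i j z * dirD bU g (toBase z) := by
  have hz' : proj (Nat.le_succ 1) z ∈ jetsOver 1 M := hz
  -- The first-order formula holds at all jets over M, hence near the given one, so it may be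
  -- substituted under the outer total derivative.
  rw [D_congr (isOpen_jetsOver hM) hz' (Q := fun w => dirD (bX i) g (toBase w)
    + u₁ i w * dirD bU g (toBase w))
    (fun w hw => D_comp_toBase (differentiableAt_of_mem hM hg hw))]
  have h1 := fun v => differentiableAt_of_mem hM (contDiffOn_dirD hM hg v) hz
  have h2 := fun v => differentiableAt_comp_toBase (z := proj (Nat.le_succ 1) z) (h1 v)
  have h3 := (differentiable_u₁ i) (proj (Nat.le_succ 1) z)
  rw [D_add (h2 _) (h3.fun_mul (h2 _)), D_mul h3 (h2 _), D_comp_toBase (h1 _), D_comp_toBase (h1 _),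
    D_u₁, dirD_comm hM hg hz bU (bX i)]
  change _ + u₁ j (proj one_le_two z) * _ + (u₁ i (proj one_le_two z) * (_ +
    u₁ j (proj one_le_two z) * _) + dirD bU g (toBase z) * _) = _
  ring

/-! ### Coordinate expressions of the equation and of the Lagrangian -/

lemma D_u₀ (i : Fin 3) : D i u₀ = u₁ i := by
  funext z
  have h : DifferentiableAt ℝ (fun p : Base => p.2) (toBase z) := differentiableAt_snd
  have := D_comp_toBase (i := i) (n := 0) (g := fun p => p.2) h
  rw [dirD_snd_at, dirD_snd_at] at this
  simp only [zero_add, mul_one] at this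
  exact this

lemma X_u₀ : X u₀ = fun z : Jet 1 => u₁ 0 z + 2 * z.1 1 * u₁ 2 z := by
  funext z; simp only [X, D_u₀]

lemma Y_u₀ : Y u₀ = fun z : Jet 1 => u₁ 1 z - 2 * z.1 0 * u₁ 2 z := by
  funext z; simp only [Y, D_u₀]

lemma D_coord_mul_u₁ (i j k : Fin 3) (z : Jet 2) :
    D i (fun w : Jet 1 => 2 * w.1 j * u₁ k w) z =
      2 * z.1 j * u₂ k i z + u₁ k (proj one_le_two z) * (2 * if j = i then 1 else 0) := by
  have hj : DifferentiableAt ℝ (fun w : Jet 1 => w.1 j) (proj (Nat.le_succ 1) z) := by fun_prop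
  rw [D_mul (hj.const_mul 2) (differentiable_u₁ k _), D_u₁, D_mul (by fun_prop) hj, D_coord,
    show D i (fun _ : Jet 1 => (2 : ℝ)) z = 0 by simp [D]]
  simp only [proj, mul_zero, add_zero]

lemma criticalEq_eq : criticalEq = fun z => u₂ 0 0 z + u₂ 1 1 z
    + 4 * (z.1 0 ^ 2 + z.1 1 ^ 2) * u₂ 2 2 z + 4 * z.1 1 * u₂ 0 2 z - 4 * z.1 0 * u₂ 1 2 z
    + (toBase z).2 ^ 3 := by
  funext z
  have h := fun k => differentiable_u₁ k (proj (Nat.le_succ 1) z)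
  have h' : ∀ j k, DifferentiableAt ℝ (fun w : Jet 1 => 2 * w.1 j * u₁ k w)
      (proj (Nat.le_succ 1) z) := fun j k =>
    DifferentiableAt.fun_mul (by fun_prop) (differentiable_u₁ k _)
  have hX : ∀ i, D i (fun z : Jet 1 => u₁ 0 z + 2 * z.1 1 * u₁ 2 z) z = _ := fun i =>
    (D_add (h 0) (h' 1 2)).trans (congrArg₂ _ (D_u₁ i 0 z) (D_coord_mul_u₁ i 1 2 z))
  have hY : ∀ i, D i (fun z : Jet 1 => u₁ 1 z - 2 * z.1 0 * u₁ 2 z) z = _ := fun i =>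
    (D_sub (h 1) (h' 0 2)).trans (congrArg₂ _ (D_u₁ i 1 z) (D_coord_mul_u₁ i 0 2 z))
  rw [criticalEq, X_u₀, Y_u₀, X, Y, hX, hX, hY, hY, u₂_comm 2 0, u₂_comm 2 1]
  simp
  ring

lemma lagrangian_eq : lagrangian = fun z => 1 / 2 * (u₁ 0 z + 2 * z.1 1 * u₁ 2 z) ^ 2
    + 1 / 2 * (u₁ 1 z - 2 * z.1 0 * u₁ 2 z) ^ 2 - (toBase z).2 ^ 4 / 4 := by
  funext z
  simp only [lagrangian, X_u₀, Y_u₀]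

/-- Jet coordinates are affine along z + s v, so differentiating a polynomial in them becomes
one-variable calculus. -/
lemma lineDeriv_eq {n : ℕ} {P : Jet n → ℝ} {z v : Jet n} {c : ℝ} (hP : DifferentiableAt ℝ P z)
    (h : HasDerivAt (fun s : ℝ => P (z + s • v)) c 0) : fderiv ℝ P z v = c := by
  rw [← hP.lineDeriv_eq_fderiv]
  exact h.deriv

lemma hasDerivAt_affine (a b : ℝ) : HasDerivAt (fun s : ℝ => a + s * b) b 0 := by
  simpa using ((hasDerivAt_id (0 : ℝ)).mul_const b).const_add a

lemma fderiv_criticalEq (z v : Jet 2) : fderiv ℝ criticalEq z v =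
    u₂ 0 0 v + u₂ 1 1 v + 4 * (z.1 0 ^ 2 + z.1 1 ^ 2) * u₂ 2 2 v
      + 8 * (z.1 0 * v.1 0 + z.1 1 * v.1 1) * u₂ 2 2 z
      + 4 * z.1 1 * u₂ 0 2 v + 4 * v.1 1 * u₂ 0 2 z
      - 4 * z.1 0 * u₂ 1 2 v - 4 * v.1 0 * u₂ 1 2 z + 3 * (toBase z).2 ^ 2 * (toBase v).2 := by
  apply lineDeriv_eq
  · rw [criticalEq_eq]; unfold u₂ toBase; fun_prop
  have hu : ∀ i j, HasDerivAt (fun s : ℝ => u₂ i j (z + s • v)) (u₂ i j v) 0 :=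
    fun i j => hasDerivAt_affine _ _
  have hx : ∀ i, HasDerivAt (fun s : ℝ => (z + s • v).1 i) (v.1 i) 0 :=
    fun i => hasDerivAt_affine _ _
  have hb : HasDerivAt (fun s : ℝ => (toBase (z + s • v)).2) (toBase v).2 0 :=
    hasDerivAt_affine _ _
  rw [criticalEq_eq]
  refine (((((((hu 0 0).add (hu 1 1)).add (((((hx 0).pow 2).add
    ((hx 1).pow 2)).const_mul 4).mul (hu 2 2))).add (((hx 1).const_mul 4).mul (hu 0 2))).sub
    (((hx 0).const_mul 4).mul (hu 1 2))).add (hb.pow 3))).congr_deriv ?_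
  simp
  ring

lemma fderiv_lagrangian (z v : Jet 1) : fderiv ℝ lagrangian z v =
    (u₁ 0 z + 2 * z.1 1 * u₁ 2 z) * (u₁ 0 v + 2 * z.1 1 * u₁ 2 v + 2 * v.1 1 * u₁ 2 z)
      + (u₁ 1 z - 2 * z.1 0 * u₁ 2 z) * (u₁ 1 v - 2 * z.1 0 * u₁ 2 v - 2 * v.1 0 * u₁ 2 z)
      - (toBase z).2 ^ 3 * (toBase v).2 := by
  apply lineDeriv_eq
  · rw [lagrangian_eq]; unfold u₁ toBase; fun_prop
  have hu : ∀ i, HasDerivAt (fun s : ℝ => u₁ i (z + s • v)) (u₁ i v) 0 :=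
    fun i => hasDerivAt_affine _ _
  have hx : ∀ i, HasDerivAt (fun s : ℝ => (z + s • v).1 i) (v.1 i) 0 :=
    fun i => hasDerivAt_affine _ _
  have hb : HasDerivAt (fun s : ℝ => (toBase (z + s • v)).2) (toBase v).2 0 :=
    hasDerivAt_affine _ _
  rw [lagrangian_eq]
  refine ((((((hu 0).add (((hx 1).const_mul 2).mul (hu 2))).pow 2).const_mul (1 / 2)).add
    ((((hu 1).sub (((hx 0).const_mul 2).mul (hu 2))).pow 2).const_mul (1 / 2))).sub
    ((hb.pow 4).div_const 4)).congr_deriv ?_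
  simp
  ring

/-! ### Coordinate expressions of the prolongations -/

lemma u₁_single (i : Fin 3) (α : Idx 1) (x : Fin 3 → ℝ) :
    u₁ i (x, Pi.single α 1) = if e i = α.1 then 1 else 0 := by
  simp [u₁, Pi.single_apply, Subtype.ext_iff]

lemma u₂_single (i j : Fin 3) (α : Idx 2) (x : Fin 3 → ℝ) :
    u₂ i j (x, Pi.single α 1) = if e i + e j = α.1 then 1 else 0 := by
  simp [u₂, Pi.single_apply, Subtype.ext_iff]

lemma toBase_single {n : ℕ} (α : Idx n) (x : Fin 3 → ℝ) :
    (toBase (x, Pi.single α 1)).2 = if 0 = α.1 then 1 else 0 := by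
  simp [toBase, Pi.single_apply, Subtype.ext_iff]

lemma u₁_base (i : Fin 3) (x : Fin 3 → ℝ) : u₁ i (x, 0) = 0 := rfl

lemma u₂_base (i j : Fin 3) (x : Fin 3 → ℝ) : u₂ i j (x, 0) = 0 := rfl

lemma toBase_base {n : ℕ} (x : Fin 3 → ℝ) : (toBase ((x, 0) : Jet n)).2 = 0 := rfl

namespace PointField

variable (W : PointField) {M : Set Base}

lemma pr₂_criticalEq (z : Jet 2) : W.pr₂ criticalEq z =
    W.ξ 0 (toBase z) * (8 * z.1 0 * u₂ 2 2 z - 4 * u₂ 1 2 z)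
      + W.ξ 1 (toBase z) * (8 * z.1 1 * u₂ 2 2 z + 4 * u₂ 0 2 z)
      + 3 * (toBase z).2 ^ 2 * W.η (toBase z)
      + (W.η₂ 0 0 z + W.η₂ 1 1 z + 4 * (z.1 0 ^ 2 + z.1 1 ^ 2) * W.η₂ 2 2 z
        + 4 * z.1 1 * W.η₂ 0 2 z - 4 * z.1 0 * W.η₂ 1 2 z) := by
  have h0 : Finset.Ici (0 : Fin 3) = {0, 1, 2} := rfl
  have h1 : Finset.Ici (1 : Fin 3) = {1, 2} := rfl
  have h2 : Finset.Ici (2 : Fin 3) = {2} := rfl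
  -- Multi-indices of different orders are distinct, so each coordinate vector meets only its own
  -- coordinate in the derivative of F.
  have hne : ∀ i j : Fin 3, 0 ≠ e i + e j := by decide
  have hne' : ∀ i j k : Fin 3, e i + e j ≠ e k := by decide
  have hz : ∀ i : Fin 3, 0 ≠ e i := by decide
  have hz2 : ∀ i j : Fin 3, e i + e j ≠ 0 := by decide
  simp only [pr₂, pdX, pdU, fderiv_criticalEq, Fin.sum_univ_three, h0, h1, h2, u₂_single,
    toBase_single, u₂_base, toBase_base, hne, hne', hz, hz2]
  simp (decide := true)
  ring

lemma pr₁_lagrangian (z : Jet 1) : W.pr₁ lagrangian z =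
    (u₁ 0 z + 2 * z.1 1 * u₁ 2 z) *
        (W.η₁ 0 z + 2 * z.1 1 * W.η₁ 2 z + 2 * W.ξ 1 (toBase z) * u₁ 2 z)
      + (u₁ 1 z - 2 * z.1 0 * u₁ 2 z) *
        (W.η₁ 1 z - 2 * z.1 0 * W.η₁ 2 z - 2 * W.ξ 0 (toBase z) * u₁ 2 z)
      - (toBase z).2 ^ 3 * W.η (toBase z) := by
  have hz : ∀ i : Fin 3, 0 ≠ e i := by decide
  have hz2 : ∀ i : Fin 3, e i ≠ 0 := by decide
  simp only [pr₁, pdX, pdU, fderiv_lagrangian, Fin.sum_univ_three, u₁_single,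
    toBase_single, u₁_base, toBase_base, hz, hz2]
  simp (decide := true)
  ring

variable {W}

lemma Dξ_eq (hM : IsOpen M) (hW : W.SmoothOn M) {z : Jet 1} (hz : toBase z ∈ M) (i k : Fin 3) :
    W.Dξ i k z = dirD (bX i) (W.ξ k) (toBase z) + u₁ i z * dirD bU (W.ξ k) (toBase z) :=
  D_comp_toBase (differentiableAt_of_mem hM (hW.1 k) hz)

lemma η₁_eq (hM : IsOpen M) (hW : W.SmoothOn M) {z : Jet 1} (hz : toBase z ∈ M) (i : Fin 3) :
    W.η₁ i z = dirD (bX i) W.η (toBase z) + u₁ i z * dirD bU W.η (toBase z)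
      - ∑ k, u₁ k z * W.Dξ i k z := by
  rw [η₁, D_comp_toBase (differentiableAt_of_mem hM hW.2 hz)]
  rfl

lemma differentiableAt_D (hM : IsOpen M) {g : Base → ℝ} (hg : ContDiffOn ℝ ∞ g M) {z : Jet 1}
    (hz : toBase z ∈ M) (i : Fin 3) :
    DifferentiableAt ℝ (D i fun w : Jet 0 => g (toBase w)) z := by
  have h2 := fun v => differentiableAt_comp_toBase (z := z)
    (differentiableAt_of_mem hM (contDiffOn_dirD hM hg v) hz)
  have := (h2 (bX i)).fun_add ((differentiable_u₁ i z).fun_mul (h2 bU))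
  refine this.congr_of_eventuallyEq ?_
  exact Filter.eventuallyEq_of_mem ((isOpen_jetsOver hM).mem_nhds hz)
    (fun w hw => D_comp_toBase (differentiableAt_of_mem hM hg hw))

lemma η₂_eq (hM : IsOpen M) (hW : W.SmoothOn M) {z : Jet 2} (hz : toBase z ∈ M) (i j : Fin 3) :
    W.η₂ i j z = D j (D i fun w : Jet 0 => W.η (toBase w)) z
      - ∑ k, (u₁ k (proj one_le_two z) * D j (D i fun w : Jet 0 => W.ξ k (toBase w)) z
          + W.Dξ i k (proj one_le_two z) * u₂ k j z)
      - ∑ k, u₂ i k z * W.Dξ j k (proj one_le_two z) := by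
  have hz' : toBase (proj (Nat.le_succ 1) z) ∈ M := hz
  have hη := differentiableAt_D hM hW.2 hz' i
  have hξ := fun k => differentiableAt_D hM (hW.1 k) hz' i
  have hm := fun k => (differentiable_u₁ k _).fun_mul (hξ k)
  unfold η₂ η₁ Dξ
  rw [D_sub hη (DifferentiableAt.fun_sum fun k _ => hm k), D_sum fun k _ => hm k]
  simp only [D_mul (differentiable_u₁ _ _) (hξ _), D_u₁]

end PointField

/-! ### The eight generators -/

section

variable {f g : Base → ℝ} {v : Base}

lemma dirD_fun_add (hf : Differentiable ℝ f) (hg : Differentiable ℝ g) :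
    dirD v (fun p => f p + g p) = fun q => dirD v f q + dirD v g q :=
  funext fun q => dirD_add_at (hf q) (hg q)

lemma dirD_fun_sub (hf : Differentiable ℝ f) (hg : Differentiable ℝ g) :
    dirD v (fun p => f p - g p) = fun q => dirD v f q - dirD v g q :=
  funext fun q => dirD_sub_at (hf q) (hg q)

lemma dirD_fun_neg : dirD v (fun p => -f p) = fun q => -dirD v f q :=
  funext fun _ => dirD_neg_at

lemma dirD_fun_mul (hf : Differentiable ℝ f) (hg : Differentiable ℝ g) :
    dirD v (fun p => f p * g p) = fun q => f q * dirD v g q + g q * dirD v f q :=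
  funext fun q => dirD_mul_at (hf q) (hg q)

lemma dirD_fun_pow (hf : Differentiable ℝ f) (n : ℕ) :
    dirD v (fun p => f p ^ n) = fun q => n * f q ^ (n - 1) * dirD v f q :=
  funext fun q => dirD_pow_at (hf q) n

lemma dirD_bX_coord (i j : Fin 3) :
    dirD (bX i) (fun p => p.1 j) = fun _ => if j = i then 1 else 0 :=
  funext fun _ => (dirD_coord_at j).trans (Pi.single_apply i 1 j)

lemma dirD_bU_coord (j : Fin 3) : dirD bU (fun p => p.1 j) = fun _ => 0 :=
  funext fun _ => dirD_coord_at j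

lemma dirD_bX_snd (i : Fin 3) : dirD (bX i) (fun p => p.2) = fun _ => 0 :=
  funext fun _ => dirD_snd_at

lemma dirD_bU_snd : dirD bU (fun p => p.2) = fun _ => 1 :=
  funext fun _ => dirD_snd_at

end

lemma smoothOn_generators : ∀ W ∈ [fieldT, fieldR, fieldXt, fieldYt, fieldZ, fieldV₁, fieldV₂,
    fieldV₃], W.SmoothOn Set.univ := by
  simp only [List.forall_mem_cons, List.not_mem_nil, false_imp_iff, implies_true, and_true]
  refine ⟨?_, ?_, ?_, ?_, ?_, ?_, ?_, ?_⟩ <;>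
  · refine ⟨fun i => ContDiff.contDiffOn ?_, ContDiff.contDiffOn ?_⟩
    · fin_cases i <;>
      · simp only [fieldT, fieldR, fieldXt, fieldYt, fieldZ, fieldV₁, fieldV₂, fieldV₃, field]
        simp
        fun_prop
    · simp only [fieldT, fieldR, fieldXt, fieldYt, fieldZ, fieldV₁, fieldV₂, fieldV₃, field]
      fun_prop

-- For these fields the prolongation multiplies F by a factor on all jets, not only where F = 0. The
-- factor is forced by the cubic term: η = u η_u turns 3u²η into 3η_u u³.
set_option maxHeartbeats 2000000 in
lemma pr₂_generators : ∀ W ∈ [fieldT, fieldR, fieldXt, fieldYt, fieldZ, fieldV₁, fieldV₂,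
    fieldV₃], ∀ z, W.pr₂ criticalEq z = 3 * dirD bU W.η (toBase z) * criticalEq z := by
  intro W hW z
  have hs := smoothOn_generators W hW
  have hz : toBase z ∈ Set.univ := trivial
  have hz' : toBase (proj one_le_two z) ∈ Set.univ := trivial
  rw [W.pr₂_criticalEq, criticalEq_eq]
  simp only [PointField.η₂_eq isOpen_univ hs hz, D_D_comp_toBase isOpen_univ (hs.1 _) hz,
    D_D_comp_toBase isOpen_univ hs.2 hz, PointField.Dξ_eq isOpen_univ hs hz',
    Fin.sum_univ_three, u₂_comm 1 0, u₂_comm 2 0, u₂_comm 2 1]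
  clear hs
  revert W
  simp only [List.forall_mem_cons, List.not_mem_nil, false_imp_iff, implies_true, and_true]
  refine ⟨?_, ?_, ?_, ?_, ?_, ?_, ?_, ?_⟩ <;>
  · simp only [fieldT, fieldR, fieldXt, fieldYt, fieldZ, fieldV₁, fieldV₂, fieldV₃, field,
      Matrix.cons_val]
    simp (disch := fun_prop) [dirD_fun_add, dirD_fun_sub, dirD_fun_neg, dirD_fun_mul,
      dirD_fun_pow, dirD_bX_coord, dirD_bU_coord, dirD_bX_snd, dirD_bU_snd, dirD_fun_const,
      toBase, proj]
    try ring

/-! ### Variation of the Lagrangian and the explicit potentials -/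

namespace PointField

variable {W : PointField} {M : Set Base}

lemma variationOf_lagrangian (hM : IsOpen M) (hW : W.SmoothOn M) {z : Jet 1}
    (hz : toBase z ∈ M) : W.variationOf lagrangian z =
    (u₁ 0 z + 2 * z.1 1 * u₁ 2 z) *
        (W.η₁ 0 z + 2 * z.1 1 * W.η₁ 2 z + 2 * W.ξ 1 (toBase z) * u₁ 2 z)
      + (u₁ 1 z - 2 * z.1 0 * u₁ 2 z) *
        (W.η₁ 1 z - 2 * z.1 0 * W.η₁ 2 z - 2 * W.ξ 0 (toBase z) * u₁ 2 z)
      - (toBase z).2 ^ 3 * W.η (toBase z)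
      + (1 / 2 * (u₁ 0 z + 2 * z.1 1 * u₁ 2 z) ^ 2 + 1 / 2 * (u₁ 1 z - 2 * z.1 0 * u₁ 2 z) ^ 2
        - (toBase z).2 ^ 4 / 4) *
        ∑ i, (dirD (bX i) (W.ξ i) (toBase z) + u₁ i z * dirD bU (W.ξ i) (toBase z)) := by
  rw [variationOf, pr₁_lagrangian, lagrangian_eq]
  simp only [Dξ_eq hM hW hz]

end PointField

lemma isVariationalSymmetry_generators : ∀ W ∈ [fieldT, fieldR, fieldXt, fieldYt, fieldZ],
    W.IsVariationalSymmetry lagrangian Set.univ := by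
  intro W hW
  have hs : W.SmoothOn Set.univ := smoothOn_generators W (by
    simp only [List.mem_cons, List.not_mem_nil, or_false] at hW ⊢
    tauto)
  refine ⟨hs, fun z hz => ?_⟩
  have hz' : toBase z ∈ Set.univ := hz
  rw [PointField.variationOf_lagrangian isOpen_univ hs hz']
  simp only [PointField.η₁_eq isOpen_univ hs hz', PointField.Dξ_eq isOpen_univ hs hz',
    Fin.sum_univ_three]
  clear hs
  revert W
  simp only [List.forall_mem_cons, List.not_mem_nil, false_imp_iff, implies_true, and_true]
  refine ⟨?_, ?_, ?_, ?_, ?_⟩ <;>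
  · simp only [fieldT, fieldR, fieldXt, fieldYt, fieldZ, field, Matrix.cons_val]
    -- The goals equate a polynomial to zero; `mul_eq_zero` would break a product into a
    -- disjunction, out of reach of `ring`.
    simp (disch := fun_prop) [-mul_eq_zero, dirD_fun_mul, dirD_fun_neg, dirD_bX_coord,
      dirD_bU_coord, dirD_bX_snd, dirD_bU_snd, dirD_fun_const, toBase]
    try ring

lemma isDivergenceSymmetryWith_of_base {W : PointField} {M : Set Base} (hM : IsOpen M)
    (hW : W.SmoothOn M) {ψ : Fin 3 → Base → ℝ} (hψ : ∀ i, ContDiffOn ℝ ∞ (ψ i) M)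
    (h : ∀ z ∈ jetsOver 1 M, W.variationOf lagrangian z =
      ∑ i, (dirD (bX i) (ψ i) (toBase z) + u₁ i z * dirD bU (ψ i) (toBase z))) :
    W.IsDivergenceSymmetryWith lagrangian M fun i (z : Jet 0) => ψ i (toBase z) := by
  refine ⟨hW, fun i => (hψ i).comp contDiff_toBase.contDiffOn fun z hz => hz, fun z hz => ?_⟩
  refine (h z hz).trans ?_
  rw [Div]
  exact Finset.sum_congr rfl fun i _ =>
    (D_comp_toBase (n := 0) (differentiableAt_of_mem hM (hψ i) hz)).symm

lemma isDivergenceSymmetryWith_generators :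
    fieldV₁.IsDivergenceSymmetryWith lagrangian Set.univ potentialA ∧
    fieldV₂.IsDivergenceSymmetryWith lagrangian Set.univ potentialB ∧
    fieldV₃.IsDivergenceSymmetryWith lagrangian Set.univ potentialC := by
  have key : ∀ (W : PointField) (φ : Fin 3 → ℝ → ℝ → ℝ → ℝ → ℝ), W.SmoothOn Set.univ →
      (∀ i, ContDiff ℝ ∞ fun q : Base => φ i (q.1 0) (q.1 1) (q.1 2) q.2) →
      (∀ z : Jet 1, W.variationOf lagrangian z =
        ∑ i, (dirD (bX i) (fun q => φ i (q.1 0) (q.1 1) (q.1 2) q.2) (toBase z)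
          + u₁ i z * dirD bU (fun q => φ i (q.1 0) (q.1 1) (q.1 2) q.2) (toBase z))) →
      W.IsDivergenceSymmetryWith lagrangian Set.univ (potential φ) := fun W φ hW hφ h =>
    isDivergenceSymmetryWith_of_base isOpen_univ hW
      (ψ := fun i q => φ i (q.1 0) (q.1 1) (q.1 2) q.2) (fun i => (hφ i).contDiffOn)
      fun z _ => h z
  have hs : ∀ W ∈ [fieldV₁, fieldV₂, fieldV₃], W.SmoothOn Set.univ := fun W hW =>
    smoothOn_generators W (by
      simp only [List.mem_cons, List.not_mem_nil, or_false] at hW ⊢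
      tauto)
  have h1 := hs fieldV₁ (by simp)
  have h2 := hs fieldV₂ (by simp)
  have h3 := hs fieldV₃ (by simp)
  refine ⟨key _ _ h1 ?_ fun z => ?_, key _ _ h2 ?_ fun z => ?_, key _ _ h3 ?_ fun z => ?_⟩
  any_goals
    intro i
    fin_cases i <;>
    · simp
      fun_prop
  all_goals
    have hz : toBase z ∈ Set.univ := trivial
  · rw [PointField.variationOf_lagrangian isOpen_univ h1 hz]
    simp only [PointField.η₁_eq isOpen_univ h1 hz, PointField.Dξ_eq isOpen_univ h1 hz,
      Fin.sum_univ_three]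
    simp only [fieldV₁, field, Matrix.cons_val]
    simp (disch := fun_prop) [dirD_fun_add, dirD_fun_sub, dirD_fun_neg, dirD_fun_mul,
      dirD_fun_pow, dirD_bX_coord, dirD_bU_coord, dirD_bX_snd, dirD_bU_snd, dirD_fun_const, toBase]
    ring
  · rw [PointField.variationOf_lagrangian isOpen_univ h2 hz]
    simp only [PointField.η₁_eq isOpen_univ h2 hz, PointField.Dξ_eq isOpen_univ h2 hz,
      Fin.sum_univ_three]
    simp only [fieldV₂, field, Matrix.cons_val]
    simp (disch := fun_prop) [dirD_fun_add, dirD_fun_sub, dirD_fun_neg, dirD_fun_mul,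
      dirD_fun_pow, dirD_bX_coord, dirD_bU_coord, dirD_bX_snd, dirD_bU_snd, dirD_fun_const, toBase]
    ring
  · rw [PointField.variationOf_lagrangian isOpen_univ h3 hz]
    simp only [PointField.η₁_eq isOpen_univ h3 hz, PointField.Dξ_eq isOpen_univ h3 hz,
      Fin.sum_univ_three]
    simp only [fieldV₃, field, Matrix.cons_val]
    simp (disch := fun_prop) [dirD_fun_add, dirD_fun_sub, dirD_fun_neg, dirD_fun_mul,
      dirD_fun_pow, dirD_bX_coord, dirD_bU_coord, dirD_bX_snd, dirD_bU_snd, dirD_fun_const, toBase]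
    ring

/-! ### Horizontal derivatives on the base -/

/-- The derivative along `X = ∂/∂x + 2y ∂/∂t` of a function on the base. -/
noncomputable def hX (g : Base → ℝ) (q : Base) : ℝ :=
  dirD (bX 0) g q + 2 * q.1 1 * dirD (bX 2) g q

/-- The derivative along `Y = ∂/∂y - 2x ∂/∂t` of a function on the base. -/
noncomputable def hY (g : Base → ℝ) (q : Base) : ℝ :=
  dirD (bX 1) g q - 2 * q.1 0 * dirD (bX 2) g q

section

variable {f g : Base → ℝ} {q v w : Base} {M : Set Base}

lemma contDiffOn_hX (hM : IsOpen M) (hg : ContDiffOn ℝ ∞ g M) : ContDiffOn ℝ ∞ (hX g) M := by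
  have h0 := contDiffOn_dirD hM hg (bX 0)
  have h2 := contDiffOn_dirD hM hg (bX 2)
  unfold hX; fun_prop

lemma contDiffOn_hY (hM : IsOpen M) (hg : ContDiffOn ℝ ∞ g M) : ContDiffOn ℝ ∞ (hY g) M := by
  have h0 := contDiffOn_dirD hM hg (bX 1)
  have h2 := contDiffOn_dirD hM hg (bX 2)
  unfold hY; fun_prop

lemma hX_congr (hM : IsOpen M) (hq : q ∈ M) (h : ∀ p ∈ M, f p = g p) : hX f q = hX g q := by
  simp only [hX, dirD_congr hM hq h]

lemma hY_congr (hM : IsOpen M) (hq : q ∈ M) (h : ∀ p ∈ M, f p = g p) : hY f q = hY g q := by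
  simp only [hY, dirD_congr hM hq h]

/-- The derivative of a function of the form `g₁ + 2 xⱼ g₂`. -/
lemma dirD_add_coord_mul {g₁ g₂ : Base → ℝ} (h₁ : DifferentiableAt ℝ g₁ q)
    (h₂ : DifferentiableAt ℝ g₂ q) (j : Fin 3) :
    dirD v (fun p => g₁ p + 2 * p.1 j * g₂ p) q =
      dirD v g₁ q + 2 * q.1 j * dirD v g₂ q + 2 * v.1 j * g₂ q := by
  rw [dirD_add_at h₁ (by fun_prop), dirD_mul_at (by fun_prop) h₂, dirD_mul_at (by fun_prop)
    (by fun_prop), dirD_coord_at, dirD_fun_const]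
  ring

lemma dirD_sub_coord_mul {g₁ g₂ : Base → ℝ} (h₁ : DifferentiableAt ℝ g₁ q)
    (h₂ : DifferentiableAt ℝ g₂ q) (j : Fin 3) :
    dirD v (fun p => g₁ p - 2 * p.1 j * g₂ p) q =
      dirD v g₁ q - 2 * q.1 j * dirD v g₂ q - 2 * v.1 j * g₂ q := by
  rw [dirD_sub_at h₁ (by fun_prop), dirD_mul_at (by fun_prop) h₂, dirD_mul_at (by fun_prop)
    (by fun_prop), dirD_coord_at, dirD_fun_const]
  ring

lemma dirD_hX (hM : IsOpen M) (hg : ContDiffOn ℝ ∞ g M) (hq : q ∈ M) (v : Base) :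
    dirD v (hX g) q = dirD v (dirD (bX 0) g) q + 2 * q.1 1 * dirD v (dirD (bX 2) g) q
      + 2 * v.1 1 * dirD (bX 2) g q :=
  dirD_add_coord_mul (differentiableAt_of_mem hM (contDiffOn_dirD hM hg _) hq)
    (differentiableAt_of_mem hM (contDiffOn_dirD hM hg _) hq) 1

lemma dirD_hY (hM : IsOpen M) (hg : ContDiffOn ℝ ∞ g M) (hq : q ∈ M) (v : Base) :
    dirD v (hY g) q = dirD v (dirD (bX 1) g) q - 2 * q.1 0 * dirD v (dirD (bX 2) g) q
      - 2 * v.1 0 * dirD (bX 2) g q :=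
  dirD_sub_coord_mul (differentiableAt_of_mem hM (contDiffOn_dirD hM hg _) hq)
    (differentiableAt_of_mem hM (contDiffOn_dirD hM hg _) hq) 0

lemma dirD_bU_hX (hM : IsOpen M) (hg : ContDiffOn ℝ ∞ g M) (hq : q ∈ M) :
    dirD bU (hX g) q = hX (dirD bU g) q := by
  rw [dirD_hX hM hg hq, hX, dirD_comm hM hg hq bU, dirD_comm hM hg hq bU]
  simp

lemma dirD_bU_hY (hM : IsOpen M) (hg : ContDiffOn ℝ ∞ g M) (hq : q ∈ M) :
    dirD bU (hY g) q = hY (dirD bU g) q := by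
  rw [dirD_hY hM hg hq, hY, dirD_comm hM hg hq bU, dirD_comm hM hg hq bU]
  simp

/-- Second derivatives cancel by symmetry; only the derivatives of the coefficients 2y and -2x
survive. This bracket trades t-derivatives for horizontal ones. -/
lemma hX_hY_sub_hY_hX (hM : IsOpen M) (hg : ContDiffOn ℝ ∞ g M) (hq : q ∈ M) :
    hX (hY g) q - hY (hX g) q = -4 * dirD (bX 2) g q := by
  rw [hX, hY]
  simp only [dirD_hX hM hg hq, dirD_hY hM hg hq]
  rw [dirD_comm hM hg hq (bX 1) (bX 0), dirD_comm hM hg hq (bX 2) (bX 0),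
    dirD_comm hM hg hq (bX 2) (bX 1)]
  simp
  ring

lemma hX_mul (hf : DifferentiableAt ℝ f q) (hg : DifferentiableAt ℝ g q) :
    hX (fun p => f p * g p) q = f q * hX g q + g q * hX f q := by
  simp only [hX, dirD_mul_at hf hg]; ring

lemma hY_mul (hf : DifferentiableAt ℝ f q) (hg : DifferentiableAt ℝ g q) :
    hY (fun p => f p * g p) q = f q * hY g q + g q * hY f q := by
  simp only [hY, dirD_mul_at hf hg]; ring

/-- The sub-Laplacian acting on functions on the base, at fixed `u`. -/
noncomputable def lap (g : Base → ℝ) (q : Base) : ℝ := hX (hX g) q + hY (hY g) q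

lemma lap_eq (hM : IsOpen M) (hg : ContDiffOn ℝ ∞ g M) (hq : q ∈ M) :
    lap g q = dirD (bX 0) (dirD (bX 0) g) q + dirD (bX 1) (dirD (bX 1) g) q
      + 4 * (q.1 0 ^ 2 + q.1 1 ^ 2) * dirD (bX 2) (dirD (bX 2) g) q
      + 4 * q.1 1 * dirD (bX 2) (dirD (bX 0) g) q
      - 4 * q.1 0 * dirD (bX 2) (dirD (bX 1) g) q := by
  rw [lap, hX, hY]
  simp only [dirD_hX hM hg hq, dirD_hY hM hg hq]
  rw [dirD_comm hM hg hq (bX 0) (bX 2), dirD_comm hM hg hq (bX 1) (bX 2)]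
  simp
  ring

lemma contDiffOn_lap (hM : IsOpen M) (hg : ContDiffOn ℝ ∞ g M) : ContDiffOn ℝ ∞ (lap g) M :=
  (contDiffOn_hX hM (contDiffOn_hX hM hg)).add (contDiffOn_hY hM (contDiffOn_hY hM hg))

lemma lap_congr (hM : IsOpen M) (hq : q ∈ M) (h : ∀ p ∈ M, f p = g p) : lap f q = lap g q := by
  rw [lap, lap, hX_congr hM hq fun p hp => hX_congr hM hp h,
    hY_congr hM hq fun p hp => hY_congr hM hp h]

lemma dirD_bU_lap (hM : IsOpen M) (hg : ContDiffOn ℝ ∞ g M) (hq : q ∈ M) :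
    dirD bU (lap g) q = lap (dirD bU g) q := by
  have hx := contDiffOn_hX hM hg
  have hy := contDiffOn_hY hM hg
  unfold lap
  rw [dirD_add_at (differentiableAt_of_mem hM (contDiffOn_hX hM hx) hq)
    (differentiableAt_of_mem hM (contDiffOn_hY hM hy) hq), dirD_bU_hX hM hx hq,
    dirD_bU_hY hM hy hq, hX_congr hM hq fun p hp => dirD_bU_hX hM hg hp,
    hY_congr hM hq fun p hp => dirD_bU_hY hM hg hp]

lemma lap_zero : lap (fun _ => 0) q = 0 := by
  have hx : hX (fun _ => 0) = fun _ => 0 := by funext; simp [hX, dirD_fun_const]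
  have hy : hY (fun _ => 0) = fun _ => 0 := by funext; simp [hY, dirD_fun_const]
  simp [lap, hx, hy]

/-- Comparison of the powers of `u` in `k + 3u²η = m u³`, for `k` and `η` affine in `u` and `m`
independent of `u`. -/
lemma eq_of_cubic_relation (hM : IsOpen M) {k η m : Base → ℝ} (hk : ContDiffOn ℝ ∞ k M)
    (hη : ContDiffOn ℝ ∞ η M) (hm : ContDiffOn ℝ ∞ m M)
    (hkuu : ∀ q ∈ M, dirD bU (dirD bU k) q = 0) (hηuu : ∀ q ∈ M, dirD bU (dirD bU η) q = 0)
    (hmu : ∀ q ∈ M, dirD bU m q = 0) (h : ∀ q ∈ M, k q + 3 * q.2 ^ 2 * η q - m q * q.2 ^ 3 = 0) :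
    ∀ q ∈ M, η q = q.2 * dirD bU η q ∧ m q = 3 * dirD bU η q ∧ k q = 0 := by
  have dk := fun q hq => differentiableAt_of_mem hM (q := q) hk hq
  have dη := fun q hq => differentiableAt_of_mem hM (q := q) hη hq
  have dm := fun q hq => differentiableAt_of_mem hM (q := q) hm hq
  have dk' := fun q hq => differentiableAt_of_mem hM (q := q) (contDiffOn_dirD hM hk bU) hq
  have dη' := fun q hq => differentiableAt_of_mem hM (q := q) (contDiffOn_dirD hM hη bU) hq
  -- Differentiating three times in u replaces the comparison of coefficients. The argument is
  -- local, so M need not contain whole u-lines.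
  have h1 : ∀ q ∈ M, dirD bU k q + (6 * q.2 * η q + 3 * q.2 ^ 2 * dirD bU η q)
      - m q * (3 * q.2 ^ 2) = 0 := by
    intro q hq
    have e := dirD_congr hM hq h bU
    have := dk q hq; have := dη q hq; have := dm q hq
    rw [dirD_fun_zero, dirD_sub_at (by fun_prop) (by fun_prop), dirD_add_at (by fun_prop)
      (by fun_prop)] at e
    simp (disch := fun_prop) only [dirD_mul_at, dirD_pow_at, dirD_snd_at, dirD_fun_const,
      hmu q hq] at e
    simp at e
    linarith
  have h2 : ∀ q ∈ M, 6 * η q + 12 * q.2 * dirD bU η q - m q * (6 * q.2) = 0 := by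
    intro q hq
    have e := dirD_congr hM hq h1 bU
    have := dk' q hq; have := dη q hq; have := dm q hq; have := dη' q hq
    rw [dirD_fun_zero, dirD_sub_at (by fun_prop) (by fun_prop), dirD_add_at (by fun_prop)
      (by fun_prop), dirD_add_at (by fun_prop) (by fun_prop)] at e
    simp (disch := fun_prop) only [dirD_mul_at, dirD_pow_at, dirD_snd_at, dirD_fun_const,
      hkuu q hq, hηuu q hq, hmu q hq] at e
    simp at e
    linarith
  have h3 : ∀ q ∈ M, m q = 3 * dirD bU η q := by
    intro q hq
    have e := dirD_congr hM hq h2 bU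
    have := dη q hq; have := dm q hq; have := dη' q hq
    rw [dirD_fun_zero, dirD_sub_at (by fun_prop) (by fun_prop), dirD_add_at (by fun_prop)
      (by fun_prop)] at e
    simp (disch := fun_prop) only [dirD_mul_at, dirD_snd_at, dirD_fun_const,
      hηuu q hq, hmu q hq] at e
    simp at e
    linarith
  intro q hq
  have e3 := h3 q hq
  have e2 : η q = q.2 * dirD bU η q := by
    have := h2 q hq
    rw [e3] at this
    linarith
  refine ⟨e2, e3, ?_⟩
  have := h q hq
  rw [e3, e2] at this
  linarith

end

/-! ### The determining equations -/

/-- Jet coordinates are independent, so the symmetry condition may be tested on arbitrary numbers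
subject only to symmetry of s. -/
lemma exists_jet (q : Base) (p : Fin 3 → ℝ) (s : Fin 3 → Fin 3 → ℝ) (hs : ∀ i j, s i j = s j i) :
    ∃ z : Jet 2, toBase z = q ∧ (∀ i, u₁ i (proj one_le_two z) = p i) ∧
      ∀ i j, u₂ i j z = s i j := by
  refine ⟨(q.1, fun α => match α.1 0, α.1 1, α.1 2 with
    | 0, 0, 0 => q.2
    | 1, 0, 0 => p 0
    | 0, 1, 0 => p 1
    | 0, 0, 1 => p 2
    | 2, 0, 0 => s 0 0
    | 0, 2, 0 => s 1 1
    | 0, 0, 2 => s 2 2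
    | 1, 1, 0 => s 0 1
    | 1, 0, 1 => s 0 2
    | 0, 1, 1 => s 1 2
    -- The ten patterns above exhaust the multi-indices of order at most 2; this default is never
    -- reached.
    | _, _, _ => 0), rfl, fun i => ?_, fun i j => ?_⟩
  · fin_cases i <;> rfl
  · fin_cases i <;> fin_cases j <;> first | rfl | exact hs _ _

/-- The value of `Dᵢ g` at a jet over `q` with first derivatives `p`. -/
noncomputable def total₁ (q : Base) (p : Fin 3 → ℝ) (g : Base → ℝ) (i : Fin 3) : ℝ :=
  dirD (bX i) g q + p i * dirD bU g q

/-- The value of `Dⱼ Dᵢ g` at a jet over `q` with first derivatives `p` and second derivatives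
`s`. -/
noncomputable def total₂ (q : Base) (p : Fin 3 → ℝ) (s : Fin 3 → Fin 3 → ℝ) (g : Base → ℝ)
    (i j : Fin 3) : ℝ :=
  dirD (bX j) (dirD (bX i) g) q + p j * dirD (bX i) (dirD bU g) q
    + p i * dirD (bX j) (dirD bU g) q + p i * p j * dirD bU (dirD bU g) q + s i j * dirD bU g q

namespace PointField

variable {W : PointField} {M : Set Base}

/-- The value of `ηᵢⱼ` at a jet over `q` with first derivatives `p` and second derivatives `s`. -/
noncomputable def prolong₂ (W : PointField) (q : Base) (p : Fin 3 → ℝ) (s : Fin 3 → Fin 3 → ℝ)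
    (i j : Fin 3) : ℝ :=
  total₂ q p s W.η i j - ∑ k, (p k * total₂ q p s (W.ξ k) i j + total₁ q p (W.ξ k) i * s k j)
    - ∑ k, s i k * total₁ q p (W.ξ k) j

lemma IsLiePointSymmetry.condition (hM : IsOpen M) (h : W.IsLiePointSymmetry criticalEq M)
    {q : Base} (hq : q ∈ M) (p : Fin 3 → ℝ) (s : Fin 3 → Fin 3 → ℝ) (hs : ∀ i j, s i j = s j i)
    (hF : s 0 0 + s 1 1 + 4 * (q.1 0 ^ 2 + q.1 1 ^ 2) * s 2 2 + 4 * q.1 1 * s 0 2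
      - 4 * q.1 0 * s 1 2 + q.2 ^ 3 = 0) :
    W.ξ 0 q * (8 * q.1 0 * s 2 2 - 4 * s 1 2) + W.ξ 1 q * (8 * q.1 1 * s 2 2 + 4 * s 0 2)
      + 3 * q.2 ^ 2 * W.η q
      + (W.prolong₂ q p s 0 0 + W.prolong₂ q p s 1 1
        + 4 * (q.1 0 ^ 2 + q.1 1 ^ 2) * W.prolong₂ q p s 2 2
        + 4 * q.1 1 * W.prolong₂ q p s 0 2 - 4 * q.1 0 * W.prolong₂ q p s 1 2) = 0 := by
  obtain ⟨z, rfl, hp, hs'⟩ := exists_jet q p s hs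
  have hz0 : ∀ i, (toBase z).1 i = z.1 i := fun _ => rfl
  have hz1 : toBase (proj one_le_two z) ∈ M := hq
  have hη : ∀ i j, W.η₂ i j z = W.prolong₂ (toBase z) p s i j := by
    intro i j
    rw [η₂_eq hM h.1 hq]
    simp only [D_D_comp_toBase hM (h.1.1 _) hq, D_D_comp_toBase hM h.1.2 hq, Dξ_eq hM h.1 hz1,
      hp, hs']
    rfl
  have h0 := h.2 z hq (by simpa only [criticalEq_eq, hs', hz0] using hF)
  simpa only [pr₂_criticalEq, hη, hs', hz0] using h0

lemma IsLiePointSymmetry.dirD_bU_ξ (hM : IsOpen M) (h : W.IsLiePointSymmetry criticalEq M)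
    {q : Base} (hq : q ∈ M) (k : Fin 3) : dirD bU (W.ξ k) q = 0 := by
  -- The entry for u_xx solves F = 0, leaving u_x = p, u_xy = a, u_xt = b, u_yy = c free. Mixed
  -- differences in p and one of a, b, c then isolate the coefficients of u_x u_yy, u_x u_xy and u_x
  -- u_xt, in which only the u-derivatives of ξ occur.
  have G := fun p a b c : ℝ => h.condition hM hq ![p, 0, 0]
    ![![-(c + 4 * q.1 1 * b + q.2 ^ 3), a, b], ![a, c, 0], ![b, 0, 0]]
    (by intro i j; fin_cases i <;> fin_cases j <;> rfl) (by simp; ring)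
  simp only [prolong₂, total₁, total₂, Fin.sum_univ_three, Matrix.cons_val] at G
  have h0 : dirD bU (W.ξ 0) q = 0 := by
    linear_combination (G 1 0 0 1 - G 0 0 0 1 - G 1 0 0 0 + G 0 0 0 0) / 2
  have h1 : dirD bU (W.ξ 1) q = 0 := by
    linear_combination -(G 1 1 0 0 - G 0 1 0 0 - G 1 0 0 0 + G 0 0 0 0) / 2
  have h2 : dirD bU (W.ξ 2) q = 0 := by
    linear_combination -(G 1 0 1 0 - G 0 0 1 0 - G 1 0 0 0 + G 0 0 0 0) / 2 + 2 * q.1 1 * h0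
  fin_cases k <;> assumption

lemma IsLiePointSymmetry.determining (hM : IsOpen M) (h : W.IsLiePointSymmetry criticalEq M)
    {q : Base} (hq : q ∈ M) :
    lap W.η q + 3 * q.2 ^ 2 * W.η q - (dirD bU W.η q - 2 * hX (W.ξ 0) q) * q.2 ^ 3 = 0 ∧
    dirD bU (dirD bU W.η) q = 0 ∧
    hX (W.ξ 1) q = -hY (W.ξ 0) q ∧
    hY (W.ξ 1) q = hX (W.ξ 0) q ∧
    hX (W.ξ 2) q = 2 * W.ξ 1 q + 2 * q.1 1 * hX (W.ξ 0) q + 2 * q.1 0 * hY (W.ξ 0) q ∧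
    hY (W.ξ 2) q = -2 * W.ξ 0 q + 2 * q.1 1 * hY (W.ξ 0) q - 2 * q.1 0 * hX (W.ξ 0) q := by
  have hξ := fun k => h.dirD_bU_ξ hM hq k
  have hξ' : ∀ k v, dirD v (dirD bU (W.ξ k)) q = 0 := fun k v =>
    (dirD_congr hM hq (fun p hp => h.dirD_bU_ξ hM hp k) v).trans dirD_fun_zero
  -- Same choice of jet, with u_yt = d also free. Unit differences in a, c, b, d give the four
  -- equations for ξ, the second difference in p gives η_uu, and the value at zero gives the cubic
  -- relation.
  have G := fun p a b c d : ℝ => h.condition hM hq ![p, 0, 0]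
    ![![-(c + 4 * q.1 1 * b - 4 * q.1 0 * d + q.2 ^ 3), a, b], ![a, c, d], ![b, d, 0]]
    (by intro i j; fin_cases i <;> fin_cases j <;> rfl) (by simp; ring)
  simp only [prolong₂, total₁, total₂, Fin.sum_univ_three, Matrix.cons_val, hξ, hξ'] at G
  rw [lap_eq hM h.1.2 hq]
  simp only [hX, hY]
  have e1 : hX (W.ξ 1) q = -hY (W.ξ 0) q := by
    simp only [hX, hY]
    linear_combination -(G 0 1 0 0 0 - G 0 0 0 0 0) / 2
  have e2 : hY (W.ξ 1) q = hX (W.ξ 0) q := by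
    simp only [hX, hY]
    linear_combination -(G 0 0 0 1 0 - G 0 0 0 0 0) / 2
  simp only [hX, hY] at e1 e2
  refine ⟨?_, ?_, e1, e2, ?_, ?_⟩
  · linear_combination G 0 0 0 0 0
  · linear_combination (G 1 0 0 0 0 + G (-1) 0 0 0 0 - 2 * G 0 0 0 0 0) / 2
  · linear_combination -(G 0 0 1 0 0 - G 0 0 0 0 0) / 2
  · linear_combination -(G 0 0 0 0 1 - G 0 0 0 0 0) / 2 - 2 * q.1 1 * e1 + 2 * q.1 0 * e2

/-- The divergence of the base part of a point symmetry. -/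
lemma IsLiePointSymmetry.sum_dirD_ξ (hM : IsOpen M) (h : W.IsLiePointSymmetry criticalEq M)
    {q : Base} (hq : q ∈ M) : ∑ i, dirD (bX i) (W.ξ i) q = 4 * hX (W.ξ 0) q := by
  have hs := h.1.1
  have dξ := fun k => differentiableAt_of_mem hM (hs k) hq
  have dX := differentiableAt_of_mem hM (contDiffOn_hX hM (hs 0)) hq
  have dY := differentiableAt_of_mem hM (contDiffOn_hY hM (hs 0)) hq
  have det := fun p (hp : p ∈ M) => h.determining hM hp
  have c0 := hX_hY_sub_hY_hX hM (hs 0) hq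
  have c1 := hX_hY_sub_hY_hX hM (hs 1) hq
  have c2 := hX_hY_sub_hY_hX hM (hs 2) hq
  have a1 := hX_congr hM hq fun p hp => (det p hp).2.2.2.1
  have b1 := hY_congr hM hq fun p hp => (det p hp).2.2.1
  have a2 := hX_congr hM hq fun p hp => (det p hp).2.2.2.2.2
  have b2 := hY_congr hM hq fun p hp => (det p hp).2.2.2.2.1
  have rX : ∀ g, hX g q = dirD (bX 0) g q + 2 * q.1 1 * dirD (bX 2) g q := fun _ => rfl
  have rY : ∀ g, hY g q = dirD (bX 1) g q - 2 * q.1 0 * dirD (bX 2) g q := fun _ => rfl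
  have b1' : hY (fun p => -hY (W.ξ 0) p) q = -hY (hY (W.ξ 0)) q := by
    rw [rY, rY (hY _), dirD_neg_at, dirD_neg_at]; ring
  have a2' : hX (fun p => -2 * W.ξ 0 p + 2 * p.1 1 * hY (W.ξ 0) p
      - 2 * p.1 0 * hX (W.ξ 0) p) q = -2 * hX (W.ξ 0) q + 2 * q.1 1 * hX (hY (W.ξ 0)) q
      - 2 * q.1 0 * hX (hX (W.ξ 0)) q - 2 * hX (W.ξ 0) q := by
    have d2 : DifferentiableAt ℝ (fun p => -2 * W.ξ 0 p) q := (dξ 0).const_mul _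
    have d1 : DifferentiableAt ℝ (fun p => -2 * W.ξ 0 p + 2 * p.1 1 * hY (W.ξ 0) p) q := by
      fun_prop
    have key : ∀ v, dirD v (fun p => -2 * W.ξ 0 p + 2 * p.1 1 * hY (W.ξ 0) p
        - 2 * p.1 0 * hX (W.ξ 0) p) q = _ := fun v => dirD_sub_coord_mul d1 dX 0
    rw [rX, key, key, dirD_add_coord_mul d2 dY 1, dirD_add_coord_mul d2 dY 1,
      dirD_mul_at (by fun_prop) (dξ 0), dirD_mul_at (by fun_prop) (dξ 0), dirD_fun_const,
      dirD_fun_const, rX (hX (W.ξ 0)), rX (hY (W.ξ 0)), rX (W.ξ 0)]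
    simp
    ring
  have b2' : hY (fun p => 2 * W.ξ 1 p + 2 * p.1 1 * hX (W.ξ 0) p
      + 2 * p.1 0 * hY (W.ξ 0) p) q = 2 * hY (W.ξ 1) q + 2 * q.1 1 * hY (hX (W.ξ 0)) q
      + 2 * hX (W.ξ 0) q + 2 * q.1 0 * hY (hY (W.ξ 0)) q := by
    have d2 : DifferentiableAt ℝ (fun p => 2 * W.ξ 1 p) q := (dξ 1).const_mul _
    have d1 : DifferentiableAt ℝ (fun p => 2 * W.ξ 1 p + 2 * p.1 1 * hX (W.ξ 0) p) q := by
      fun_prop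
    have key : ∀ v, dirD v (fun p => 2 * W.ξ 1 p + 2 * p.1 1 * hX (W.ξ 0) p
        + 2 * p.1 0 * hY (W.ξ 0) p) q = _ := fun v => dirD_add_coord_mul d1 dY 0
    rw [rY, key, key, dirD_add_coord_mul d2 dX 1, dirD_add_coord_mul d2 dX 1,
      dirD_mul_at (by fun_prop) (dξ 1), dirD_mul_at (by fun_prop) (dξ 1), dirD_fun_const,
      dirD_fun_const, rY (hX (W.ξ 0)), rY (hY (W.ξ 0)), rY (W.ξ 1)]
    simp
    ring
  rw [b1'] at b1
  rw [a2'] at a2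
  rw [b2'] at b2
  obtain ⟨-, -, -, e, -, -⟩ := det q hq
  rw [Fin.sum_univ_three]
  -- Applying [X, Y] = -4∂_t to ξ₀, ξ₁, ξ₂ gives ∂_tξ₂ - 2y ∂_tξ₀ + 2x ∂_tξ₁ = 2Xξ₀; adding Xξ₀ +
  -- Yξ₁ = 2Xξ₀ makes 4Xξ₀.
  linear_combination -rX (W.ξ 0) - rY (W.ξ 1) + 3 / 2 * e + (c2 - a2 + b2) / 4
    - 2 * q.1 1 * c0 / 4 + 2 * q.1 0 * (c1 - a1 + b1) / 4

end PointField

/-! ### From the determining equations to the divergence potential -/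

namespace PointField

variable {W : PointField} {M : Set Base}

/-- The potential `(u/2) (Xη, Yη, 2y Xη - 2x Yη)` attached to a point symmetry. -/
noncomputable def symmetryPotential (W : PointField) : Fin 3 → Base → ℝ :=
  ![fun q => q.2 / 2 * hX W.η q, fun q => q.2 / 2 * hY W.η q,
    fun q => q.2 / 2 * (2 * q.1 1 * hX W.η q - 2 * q.1 0 * hY W.η q)]

/-- The cubic comparison with k = Δη and m = η_u - 2Xξ₀; its conclusion m = 3η_u becomes Xξ₀ = -η_u.
-/
lemma IsLiePointSymmetry.coefficient_relations (hM : IsOpen M)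
    (h : W.IsLiePointSymmetry criticalEq M) : ∀ q ∈ M,
    W.η q = q.2 * dirD bU W.η q ∧ hX (W.ξ 0) q = -dirD bU W.η q ∧ lap W.η q = 0 := by
  have hη := h.1.2
  have hξ := contDiffOn_hX hM (h.1.1 0)
  have hu := contDiffOn_dirD hM hη bU
  have hXξu : ∀ q ∈ M, dirD bU (hX (W.ξ 0)) q = 0 := fun q hq => by
    rw [dirD_bU_hX hM (h.1.1 0) hq, hX_congr hM hq fun p hp => h.dirD_bU_ξ hM hp 0]
    simp [hX, dirD_fun_const]
  have hηuu : ∀ q ∈ M, dirD bU (dirD bU W.η) q = 0 := fun q hq => (h.determining hM hq).2.1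
  have key := eq_of_cubic_relation hM (m := fun q => dirD bU W.η q - 2 * hX (W.ξ 0) q)
    (contDiffOn_lap hM hη) hη (by fun_prop) (fun q hq => by
      rw [dirD_congr hM hq (fun p hp => dirD_bU_lap hM hη hp), dirD_bU_lap hM hu hq,
        lap_congr hM hq hηuu, lap_zero]) hηuu (fun q hq => by
      have d := differentiableAt_of_mem hM hξ hq
      rw [dirD_sub_at (differentiableAt_of_mem hM hu hq) (by fun_prop),
        dirD_mul_at (by fun_prop) d, hXξu q hq, hηuu q hq, dirD_fun_const]
      ring) (fun q hq => (h.determining hM hq).1)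
  intro q hq
  obtain ⟨h1, h2, h3⟩ := key q hq
  exact ⟨h1, by linarith, h3⟩

/-- Criticality enters here. By div ξ = 4Xξ₀, both (Xu)² and (Yu)² carry the factor η_u - Xξ₀ + 2Xξ₀
= 0, while the potential term is -u³η - u⁴Xξ₀ = 0. The Cauchy-Riemann equations cancel the cross
terms. -/
lemma IsLiePointSymmetry.variationOf_eq (hM : IsOpen M) (h : W.IsLiePointSymmetry criticalEq M)
    {z : Jet 1} (hz : toBase z ∈ M) : W.variationOf lagrangian z =
    (u₁ 0 z + 2 * z.1 1 * u₁ 2 z) * hX W.η (toBase z)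
      + (u₁ 1 z - 2 * z.1 0 * u₁ 2 z) * hY W.η (toBase z) := by
  obtain ⟨-, -, e1, e2, e3, e4⟩ := h.determining hM hz
  obtain ⟨r1, r2, -⟩ := h.coefficient_relations hM _ hz
  have hdiv := h.sum_dirD_ξ hM hz
  have hξ := fun k => h.dirD_bU_ξ hM hz k
  rw [variationOf_lagrangian hM h.1 hz]
  simp only [hξ, mul_zero, add_zero, hdiv, η₁_eq hM h.1 hz, Dξ_eq hM h.1 hz, Fin.sum_univ_three]
  have hz0 : ∀ i, (toBase z).1 i = z.1 i := fun _ => rfl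
  simp only [hX, hY, hz0] at r2 e1 e2 e3 e4 ⊢
  linear_combination
    -(u₁ 0 z + 2 * z.1 1 * u₁ 2 z) * (u₁ 1 z * e1 + u₁ 2 z * e3)
      - (u₁ 1 z - 2 * z.1 0 * u₁ 2 z) * (u₁ 1 z * e2 + u₁ 2 z * e4) - (toBase z).2 ^ 3 * r1
      + ((u₁ 0 z + 2 * z.1 1 * u₁ 2 z) ^ 2 + (u₁ 1 z - 2 * z.1 0 * u₁ 2 z) ^ 2
        - (toBase z).2 ^ 4) * r2

/-- The divergence of the potential has three parts: half of Xu·Xη + Yu·Yη from differentiating u/2,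
another half from the u-dependence of Xη and Yη, and (u/2)Δη = 0. -/
lemma IsLiePointSymmetry.isDivergenceSymmetry (hM : IsOpen M)
    (h : W.IsLiePointSymmetry criticalEq M) : W.IsDivergenceSymmetry lagrangian M := by
  have hη := h.1.2
  have cX := contDiffOn_hX hM hη
  have cY := contDiffOn_hY hM hη
  refine ⟨0, _, isDivergenceSymmetryWith_of_base hM h.1 (ψ := W.symmetryPotential) ?_ ?_⟩
  · intro i
    fin_cases i <;>
    · simp [symmetryPotential]
      fun_prop
  intro z hz
  have hz' : toBase z ∈ M := hz
  have dX := differentiableAt_of_mem hM cX hz'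
  have dY := differentiableAt_of_mem hM cY hz'
  have du := differentiableAt_of_mem hM (contDiffOn_dirD hM hη bU) hz'
  have rel := h.coefficient_relations hM
  -- Since X acts at fixed u, η = u η_u gives Xη = u X(η_u): Xη is again linear in u.
  have eX : (toBase z).2 * dirD bU (hX W.η) (toBase z) = hX W.η (toBase z) := by
    rw [dirD_bU_hX hM hη hz', hX_congr hM hz' fun p hp => (rel p hp).1,
      hX_mul differentiableAt_snd du]
    simp [hX, dirD_snd_at]
  have eY : (toBase z).2 * dirD bU (hY W.η) (toBase z) = hY W.η (toBase z) := by
    rw [dirD_bU_hY hM hη hz', hY_congr hM hz' fun p hp => (rel p hp).1,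
      hY_mul differentiableAt_snd du]
    simp [hY, dirD_snd_at]
  have hl := (rel _ hz').2.2
  rw [lap, hX, hY] at hl
  have hz0 : ∀ i, (toBase z).1 i = z.1 i := fun _ => rfl
  rw [h.variationOf_eq hM hz', Fin.sum_univ_three]
  simp only [symmetryPotential, Matrix.cons_val]
  have hhalf : ∀ v q, dirD v (fun p : Base => p.2 / 2) q = v.2 / 2 := fun v q => by
    simp only [div_eq_mul_inv]
    rw [dirD_mul_at differentiableAt_snd (by fun_prop), dirD_snd_at, dirD_fun_const]
    ring
  have hmul : ∀ v (g : Base → ℝ), DifferentiableAt ℝ g (toBase z) →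
      dirD v (fun p : Base => p.2 / 2 * g p) (toBase z) =
        (toBase z).2 / 2 * dirD v g (toBase z) + g (toBase z) * (v.2 / 2) := fun v g hg => by
    rw [dirD_mul_at (by fun_prop) hg, hhalf]
  have hlin : ∀ v, dirD v (fun q => 2 * q.1 1 * hX W.η q - 2 * q.1 0 * hY W.η q) (toBase z) =
      2 * z.1 1 * dirD v (hX W.η) (toBase z) + 2 * v.1 1 * hX W.η (toBase z)
        - 2 * z.1 0 * dirD v (hY W.η) (toBase z) - 2 * v.1 0 * hY W.η (toBase z) := fun v => by
    rw [dirD_sub_coord_mul (by fun_prop) dY, dirD_mul_at (by fun_prop) dX,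
      dirD_mul_at (by fun_prop) (by fun_prop), dirD_coord_at, dirD_fun_const]
    simp only [hz0]
    ring
  have hz3 : DifferentiableAt ℝ (fun q => 2 * q.1 1 * hX W.η q - 2 * q.1 0 * hY W.η q)
      (toBase z) := by fun_prop
  simp only [hmul _ _ dX, hmul _ _ dY, hmul _ _ hz3, hlin]
  simp only [hz0] at hl ⊢
  simp
  linear_combination -(toBase z).2 / 2 * hl - (u₁ 0 z + 2 * z.1 1 * u₁ 2 z) / 2 * eX
    - (u₁ 1 z - 2 * z.1 0 * u₁ 2 z) / 2 * eY

end PointField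

end KohnLaplace

theorem theorem2 :
    -- every Lie point symmetry, on any open set `M` of `(x, y, t, u)`, is a divergence symmetry
    (∀ (M : Set KohnLaplace.Base), IsOpen M → ∀ W : KohnLaplace.PointField,
      W.IsLiePointSymmetry KohnLaplace.criticalEq M →
        W.IsDivergenceSymmetry KohnLaplace.lagrangian M) ∧
    -- the eight generators are Lie point symmetries
    (∀ W ∈ [KohnLaplace.fieldT, KohnLaplace.fieldR, KohnLaplace.fieldXt, KohnLaplace.fieldYt,
        KohnLaplace.fieldZ, KohnLaplace.fieldV₁, KohnLaplace.fieldV₂, KohnLaplace.fieldV₃],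
      W.IsLiePointSymmetry KohnLaplace.criticalEq Set.univ) ∧
    -- five of them are variational symmetries
    (∀ W ∈ [KohnLaplace.fieldT, KohnLaplace.fieldR, KohnLaplace.fieldXt, KohnLaplace.fieldYt,
        KohnLaplace.fieldZ],
      W.IsVariationalSymmetry KohnLaplace.lagrangian Set.univ) ∧
    -- the other three are divergence symmetries with the potentials `A`, `B`, `C`
    KohnLaplace.fieldV₁.IsDivergenceSymmetryWith KohnLaplace.lagrangian Set.univ
      KohnLaplace.potentialA ∧
    KohnLaplace.fieldV₂.IsDivergenceSymmetryWith KohnLaplace.lagrangian Set.univ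
      KohnLaplace.potentialB ∧
    KohnLaplace.fieldV₃.IsDivergenceSymmetryWith KohnLaplace.lagrangian Set.univ
      KohnLaplace.potentialC := by
  refine ⟨fun M hM W h => h.isDivergenceSymmetry hM, fun W hW => ?_,
    KohnLaplace.isVariationalSymmetry_generators,
    KohnLaplace.isDivergenceSymmetryWith_generators⟩
  refine ⟨KohnLaplace.smoothOn_generators W hW, fun z _ hF => ?_⟩
  rw [KohnLaplace.pr₂_generators W hW z, hF, mul_zero]
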